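/- Let $\delta>0$ and let $X$ be a proper geodesic metric space, with distance $|xy|$, which is $\delta$-hyperbolic: $(x|y)_w\ge\min\{(x|z)_w,(y|z)_w\}-\delta$ for all $x,y,z,w\in X$, where $(x|y)_w=\tfrac12(|xw|+|yw|-|xy|)$. Let $G$ be a finitely generated group acting by isometries on $X$. Let $\xi\in G$ act as a hyperbolic isometry (for some $x\in X$, the map $n\mapsto\xi^n(x)$ is a quasi-isometric embedding of $\mathbb Z$ into $X$), with minimal displacement $L=\inf_{x\in X}|x\,\xi(x)|\ge 300\,\delta$. Let $0<\epsilon<\delta$ and let $O\in X$ satisfy $|O\,\xi(O)|\le L+\epsilon$. Put $\|\beta\|=|O\,\beta(O)|$ for $\beta\in G$. For $i\in\mathbb Z^*=\mathbb Z\setminus\{0\}$ let $x_i=\xi^{i-1}(O)$ if $i>0$ and $x_i=\xi^{i}(O)$ if $i<0$, and let $D_i=\{x\in X: |xx_i|\le|xx_j|\text{ for all }j\in\mathbb Z^*\}$. The index of a point $x\in X$ is the smallest $i\in\mathbb Z^*$ with $x\in D_i$, and $j(\beta)$ denotes the index of $\beta(O)$. An element $\beta\in G$ is positive if $j(\beta)>0$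 and negative if $j(\beta)<0$. Put $\beta_+=\beta$, and $\beta_-=\xi^{-2j(\beta)-1}\beta$ if $\beta$ is positive, $\beta_-=\xi^{-2j(\beta)+1}\beta$ if $\beta$ is negative. We say that $D_k$ separates two points of $X$ if $k$ lies strictly between their indices. The twisted product of $\alpha,\beta\in G$ is $\alpha\star\beta=\alpha\beta_+$ if $D_1$ or $D_{-1}$ separates $\alpha^{-1}(O)$ and $\beta(O)$, and $\alpha\star\beta=\alpha\beta_-$ otherwise. Then for all $\alpha,\beta,\beta'\in G$: 1. $\alpha\star\beta=\alpha\beta_\varepsilon$ for a sign $\varepsilon\in\{+,-\}$ such that at least one of $D_{1},D_{-1},D_{2},D_{-2}$ separates $\alpha^{-1}(O)$ and $\beta_\varepsilon(O)$. 2. If $\alpha\star\beta=\alpha\star\beta'$ and $\beta,\beta'$ have the same sign, then $\beta=\beta'$. 3. $\|\alpha\|+\|\beta\|-\Delta_\star\le\|\alpha\star\beta\|\le\|\alpha\|+\|\beta\|+\Delta_\star$, where $\Delta_\star=12L+758\,\delta+12\,\epsilon$, and $\Delta_\star\le 20L$. -/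

import Mathlib

namespace TwistedProduct

section Metric

variable {X : Type*} [MetricSpace X]

/-- Any two points of `X` are joined by a geodesic segment (parametrized by arc length). -/
def IsGeodesic (X : Type*) [MetricSpace X] : Prop :=
  ∀ x y : X, ∃ γ : ℝ → X, γ 0 = x ∧ γ (dist x y) = y ∧
    ∀ s ∈ Set.Icc 0 (dist x y), ∀ t ∈ Set.Icc 0 (dist x y), dist (γ s) (γ t) = |s - t|

/-- The Gromov product `(x | y)_w`. -/
noncomputable def gromovProduct (w x y : X) : ℝ :=
  (dist x w + dist y w - dist x y) / 2

/-- `X` is `δ`-hyperbolic: `(x | y)_w ≥ min {(x | z)_w, (y | z)_w} - δ`. -/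
def IsHyperbolic (X : Type*) [MetricSpace X] (δ : ℝ) : Prop :=
  ∀ x y z w : X, min (gromovProduct w x z) (gromovProduct w y z) - δ ≤ gromovProduct w x y

/-- A quasi-isometric embedding of `ℤ` into `X`. -/
def IsQuasiIsometricEmbedding (f : ℤ → X) : Prop :=
  ∃ A B : ℝ, 1 ≤ A ∧ 0 ≤ B ∧ ∀ m n : ℤ,
    |(m : ℝ) - n| / A - B ≤ dist (f m) (f n) ∧ dist (f m) (f n) ≤ A * |(m : ℝ) - n| + B

end Metric

section Action

variable {G X : Type*} [Group G] [MetricSpace X] [MulAction G X]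

/-- `ξ` acts on `X` as a hyperbolic isometry: for some point `x`, the map `n ↦ ξⁿ(x)` is a
quasi-isometric embedding of `ℤ`. -/
def IsHyperbolicElement (X : Type*) [MetricSpace X] [MulAction G X] (ξ : G) : Prop :=
  ∃ x : X, IsQuasiIsometricEmbedding (fun n : ℤ => ξ ^ n • x)

/-- The minimal displacement `dis(ξ) = inf_x |x ξ(x)|`. -/
noncomputable def minDisplacement (X : Type*) [MetricSpace X] [MulAction G X] (ξ : G) : ℝ :=
  ⨅ x : X, dist x (ξ • x)

/-- The orbit norm `‖β‖ = |O β(O)|`. -/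
noncomputable def orbitNorm (O : X) (β : G) : ℝ := dist O (β • O)

/-- The points `x_i`, for `i ∈ ℤ \ {0}`: `x_i = ξ^{i-1}(O)` if `i > 0` and `x_i = ξ^i(O)` if
`i < 0`. (The value at `i = 0` is never used.) -/
noncomputable def orbitPoint (ξ : G) (O : X) (i : ℤ) : X :=
  if 0 < i then ξ ^ (i - 1) • O else ξ ^ i • O

/-- The Voronoi cell `D_i` of `x_i`, for `i ∈ ℤ \ {0}`. -/
def cell (ξ : G) (O : X) (i : ℤ) : Set X :=
  {x | ∀ j : ℤ, j ≠ 0 → dist x (orbitPoint ξ O i) ≤ dist x (orbitPoint ξ O j)}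

/-- The indices in `ℤ \ {0}` of the cells that contain `x`. -/
def cellIndices (ξ : G) (O : X) (x : X) : Set ℤ :=
  {i | i ≠ 0 ∧ x ∈ cell ξ O i}

/-- The smallest `i ∈ ℤ \ {0}` with `x ∈ D_i`. See `isLeast_cellIndex`: for hyperbolic `ξ` it
exists. -/
noncomputable def cellIndex (ξ : G) (O : X) (x : X) : ℤ := sInf (cellIndices ξ O x)

/-- `j(β)`: the smallest `j ∈ ℤ \ {0}` with `β(O) ∈ D_j`. -/
noncomputable def index (ξ : G) (O : X) (β : G) : ℤ := cellIndex ξ O (β • O)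

/-- `β` is positive. -/
def IsPositive (ξ : G) (O : X) (β : G) : Prop := 0 < index ξ O β

/-- `β` is negative. -/
def IsNegative (ξ : G) (O : X) (β : G) : Prop := index ξ O β < 0

/-- `β` and `β'` are both positive or both negative. -/
def SameSign (ξ : G) (O : X) (β β' : G) : Prop :=
  (IsPositive ξ O β ∧ IsPositive ξ O β') ∨ (IsNegative ξ O β ∧ IsNegative ξ O β')

open Classical in
/-- The symmetric element `β_-` of `β`. -/
noncomputable def symm (ξ : G) (O : X) (β : G) : G :=
  if IsPositive ξ O β then ξ ^ (-2 * index ξ O β - 1) * β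
  else ξ ^ (-2 * index ξ O β + 1) * β

/-- `β_ε` for a sign `ε`: `β_+ = β` and `β_-` is the symmetric element. -/
noncomputable def signed (ξ : G) (O : X) (β : G) (ε : ℤˣ) : G :=
  if ε = 1 then β else symm ξ O β

/-- The cell `D_k` separates `x` and `y`: in the order of the cells, `D_k` lies strictly between
the cells of `x` and of `y` (a point in several cells being counted in the one of smallest
index, as in the definition of the sign). -/
def Separates (ξ : G) (O : X) (k : ℤ) (x y : X) : Prop :=
  (cellIndex ξ O x < k ∧ k < cellIndex ξ O y) ∨ (cellIndex ξ O y < k ∧ k < cellIndex ξ O x)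

open Classical in
/-- The twisted product `α ⋆ β`. -/
noncomputable def star (ξ : G) (O : X) (α β : G) : G :=
  if Separates ξ O 1 (α⁻¹ • O) (β • O) ∨ Separates ξ O (-1) (α⁻¹ • O) (β • O)
  then α * signed ξ O β 1 else α * signed ξ O β (-1)

/-- For hyperbolic `ξ`, every point has a cell of smallest index. -/
theorem isLeast_cellIndex [IsIsometricSMul G X] (ξ : G) (hξ : IsHyperbolicElement X ξ)
    (O x : X) : IsLeast (cellIndices ξ O x) (cellIndex ξ O x) := by
  obtain ⟨y, A, B, hA, hB, h⟩ := hξ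
  have hA0 : 0 < A := by linarith
  -- the orbit points leave every ball
  have key : ∀ i : ℤ, |(i : ℝ)| ≤
      A * (dist x (orbitPoint ξ O i) + dist O y + dist y x + B) + 1 := by
    have aux : ∀ n : ℤ, |(n : ℝ)| ≤ A * (dist x (ξ ^ n • O) + dist O y + dist y x + B) := by
      intro n
      have h1 := (h n 0).1
      have h2 : dist (ξ ^ n • y) (ξ ^ (0 : ℤ) • y) ≤
          dist O y + dist x (ξ ^ n • O) + dist y x := by
        have e : dist (ξ ^ n • O) (ξ ^ n • y) = dist O y := dist_smul _ _ _
        rw [zpow_zero, one_smul]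
        have t1 := dist_triangle (ξ ^ n • y) (ξ ^ n • O) y
        have t2 := dist_triangle (ξ ^ n • O) x y
        rw [dist_comm (ξ ^ n • y) (ξ ^ n • O), e] at t1
        rw [dist_comm (ξ ^ n • O) x, dist_comm x y] at t2
        linarith
      have h3 : |(n : ℝ)| / A ≤ dist x (ξ ^ n • O) + dist O y + dist y x + B := by
        simp only [Int.cast_zero, sub_zero] at h1
        linarith
      rw [div_le_iff₀ hA0] at h3
      linarith
    intro i
    unfold orbitPoint
    split_ifs with hi
    · have := aux (i - 1)
      have h4 : |(i : ℝ)| ≤ |((i - 1 : ℤ) : ℝ)| + 1 := by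
        have := abs_add_le ((i : ℝ) - 1) 1
        push_cast
        simpa using this
      linarith
    · have := aux i
      linarith
  have fin : ∀ R : ℝ, {i : ℤ | dist x (orbitPoint ξ O i) ≤ R}.Finite := by
    intro R
    set M : ℝ := A * (R + dist O y + dist y x + B) + 1
    refine (Set.finite_Icc (-⌈M⌉) ⌈M⌉).subset ?_
    intro i hi
    have h1 : |(i : ℝ)| ≤ M := (key i).trans (by
      have : dist x (orbitPoint ξ O i) ≤ R := hi
      have := mul_le_mul_of_nonneg_left this hA0.le
      simp only [M]
      nlinarith)
    have h2 := h1.trans (Int.le_ceil M)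
    rw [abs_le] at h2
    exact ⟨by exact_mod_cast h2.1, by exact_mod_cast h2.2⟩
  have fin' : {i : ℤ | i ≠ 0 ∧
      dist x (orbitPoint ξ O i) ≤ dist x (orbitPoint ξ O 1)}.Finite :=
    (fin _).subset fun i hi => hi.2
  obtain ⟨i, hi, hmin⟩ := Set.exists_min_image _ (fun i => dist x (orbitPoint ξ O i)) fin'
    ⟨1, one_ne_zero, le_rfl⟩
  have hne : (cellIndices ξ O x).Nonempty := by
    refine ⟨i, hi.1, fun j hj => ?_⟩
    by_cases hj1 : dist x (orbitPoint ξ O j) ≤ dist x (orbitPoint ξ O 1)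
    · exact hmin j ⟨hj, hj1⟩
    · exact hi.2.trans (not_le.1 hj1).le
  have hbd : BddBelow (cellIndices ξ O x) :=
    (fin'.subset fun j hj => ⟨hj.1, hj.2 1 one_ne_zero⟩).bddBelow
  exact ⟨Int.csInf_mem hne hbd, fun j hj => csInf_le hbd hj⟩

end Action

end TwistedProduct

/-! Almost minimal displacement makes `n ↦ ξ ^ n • O` a broken geodesic: steps in `[L, L + ε]`, and
Gromov products at most `ε / 2 + 2 * δ` at the vertices. Since `L` is large against `δ`, a vertex
strictly between the vertices nearest to `y` and `z` has bounded `(y|z)`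
(`gromovProduct_nearest_nearest_le`). Passing from `β` to `β_-` reverses its sign and moves its
index to absolute value at least 3, so whenever `D_{±1}` fail to separate, one of `D_{±2}` separates
after the change. The norm changes little, because the new position is nearly the reflection of the
old one (`abs_orbitNorm_symm_sub_le`). Thus `α⁻¹(O)` and `β_ε(O)` are always separated by a vertex
within two steps of `O`, which makes the norm nearly additive. Cancellation holds because the index
of `β_-` determines that of `β` once the sign of `β` is known. -/

namespace TwistedProduct

/-! ### Broken geodesics in a hyperbolic space. -/

section BrokenGeodesic

variable {X : Type*} [MetricSpace X]

theorem gromovProduct_comm (w x y : X) : gromovProduct w x y = gromovProduct w y x := by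
  unfold gromovProduct
  rw [dist_comm x y]
  ring

theorem gromovProduct_add_gromovProduct (w x y : X) :
    gromovProduct w x y + gromovProduct x w y = dist w x := by
  unfold gromovProduct
  rw [dist_comm w y, dist_comm w x, dist_comm x y]
  ring

theorem gromovProduct_self (w x : X) : gromovProduct w x x = dist w x := by
  unfold gromovProduct
  rw [dist_self, dist_comm w x]
  ring

theorem gromovProduct_nonneg (w x y : X) : 0 ≤ gromovProduct w x y := by
  unfold gromovProduct
  have := dist_triangle_right x y w
  linarith

/-- If `(x | z)_w` is small and `(y | z)_w` is large, then `(x | y)_w` is small. -/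
theorem IsHyperbolic.gromovProduct_le {δ : ℝ} (hδ : IsHyperbolic X δ) {w x y z : X} {c : ℝ}
    (hxz : gromovProduct w x z ≤ c) (hyz : c + δ < gromovProduct w y z) :
    gromovProduct w x y ≤ c + δ := by
  have h := hδ x z y w
  rw [gromovProduct_comm w z y] at h
  by_contra! hlt
  have := lt_min hlt hyz
  linarith

/-- `p` is a broken geodesic with steps of length between `L` and `M` and with Gromov products
at most `c` at its vertices. -/
structure IsBrokenGeodesic (p : ℤ → X) (L M c : ℝ) : Prop where
  le_step : ∀ i, L ≤ dist (p i) (p (i + 1))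
  step_le : ∀ i, dist (p i) (p (i + 1)) ≤ M
  angle_le : ∀ i, gromovProduct (p i) (p (i - 1)) (p (i + 1)) ≤ c

/-- `p n` is a point of the sequence `p` nearest to `x`. -/
def IsNearest (p : ℤ → X) (x : X) (n : ℤ) : Prop := ∀ m, dist x (p n) ≤ dist x (p m)

namespace IsBrokenGeodesic

variable {p : ℤ → X} {L M c δ : ℝ}

theorem angle_nonneg (h : IsBrokenGeodesic p L M c) : 0 ≤ c :=
  (gromovProduct_nonneg _ _ _).trans (h.angle_le 0)

theorem reverse (h : IsBrokenGeodesic p L M c) : IsBrokenGeodesic (fun i => p (-i)) L M c where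
  le_step i := by
    have := h.le_step (-(i + 1))
    rwa [dist_comm, show -(i + 1) + 1 = -i by ring] at this
  step_le i := by
    have := h.step_le (-(i + 1))
    rwa [dist_comm, show -(i + 1) + 1 = -i by ring] at this
  angle_le i := by
    have := h.angle_le (-i)
    rw [gromovProduct_comm] at this
    rwa [show -(i - 1) = -i + 1 by ring, show -(i + 1) = -i - 1 by ring]

theorem dist_add_le (h : IsBrokenGeodesic p L M c) (i : ℤ) (m : ℕ) :
    dist (p i) (p (i + m)) ≤ m * M := by
  induction m with
  | zero => simp
  | succ m ih =>
    have h1 := dist_triangle (p i) (p (i + m)) (p (i + m + 1))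
    have h2 := h.step_le (i + m)
    push_cast
    rw [← add_assoc i (m : ℤ) 1]
    linarith

theorem dist_le (h : IsBrokenGeodesic p L M c) (i j : ℤ) :
    dist (p i) (p j) ≤ |((j - i : ℤ) : ℝ)| * M := by
  rcases le_total i j with hij | hij
  · obtain ⟨m, rfl⟩ := Int.le.dest hij
    simpa using h.dist_add_le i m
  · obtain ⟨m, rfl⟩ := Int.le.dest hij
    rw [dist_comm]
    simpa using h.dist_add_le j m

/-- The error does not accumulate with `m`: a small product at `p (i + 1)` makes the complementary
product at `p i` at least `L - (c + δ)`, so a single use of hyperbolicity restores the bound `c +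
δ`. -/
theorem gromovProduct_pred_le (hδ : IsHyperbolic X δ) (h : IsBrokenGeodesic p L M c)
    (hδ0 : 0 ≤ δ) (hL : 2 * c + 2 * δ < L) (m : ℕ) :
    ∀ i, gromovProduct (p i) (p (i - 1)) (p (i + 1 + m)) ≤ c + δ := by
  induction m with
  | zero =>
    intro i
    have := h.angle_le i
    simp only [Nat.cast_zero, add_zero]
    linarith
  | succ m ih =>
    intro i
    refine hδ.gromovProduct_le (h.angle_le i) ?_
    have h1 := ih (i + 1)
    have h2 := gromovProduct_add_gromovProduct (p i) (p (i + 1)) (p (i + 1 + 1 + m))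
    have h3 := h.le_step i
    rw [show i + 1 - 1 = i by ring] at h1
    rw [gromovProduct_comm, show i + 1 + ((m + 1 : ℕ) : ℤ) = i + 1 + 1 + m by push_cast; ring]
    linarith

theorem gromovProduct_pred_le' (hδ : IsHyperbolic X δ) (h : IsBrokenGeodesic p L M c)
    (hδ0 : 0 ≤ δ) (hL : 2 * c + 2 * δ < L) {i j : ℤ} (hij : i < j) :
    gromovProduct (p i) (p (i - 1)) (p j) ≤ c + δ := by
  obtain ⟨m, rfl⟩ := Int.le.dest (show i + 1 ≤ j from hij)
  exact h.gromovProduct_pred_le hδ hδ0 hL m i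

theorem gromovProduct_succ_le (hδ : IsHyperbolic X δ) (h : IsBrokenGeodesic p L M c)
    (hδ0 : 0 ≤ δ) (hL : 2 * c + 2 * δ < L) {i j : ℤ} (hij : i < j) :
    gromovProduct (p j) (p i) (p (j + 1)) ≤ c + δ := by
  have := h.reverse.gromovProduct_pred_le' hδ hδ0 hL (neg_lt_neg hij)
  rw [gromovProduct_comm] at this
  simpa [neg_add_eq_sub, add_comm] using this

theorem le_gromovProduct_succ (hδ : IsHyperbolic X δ) (h : IsBrokenGeodesic p L M c)
    (hδ0 : 0 ≤ δ) (hL : 2 * c + 2 * δ < L) {i j : ℤ} (hij : i < j) :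
    L - (c + δ) ≤ gromovProduct (p i) (p (i + 1)) (p j) := by
  have h3 := h.le_step i
  rcases (show i + 1 ≤ j from hij).eq_or_lt with rfl | hlt
  · have := gromovProduct_nonneg (p i) (p (i - 1)) (p (i + 1))
    have := h.angle_le i
    rw [gromovProduct_self]
    linarith
  · have h1 := h.gromovProduct_pred_le' hδ hδ0 hL hlt
    have h2 := gromovProduct_add_gromovProduct (p i) (p (i + 1)) (p j)
    rw [show i + 1 - 1 = i by ring] at h1
    linarith

theorem gromovProduct_between_le (hδ : IsHyperbolic X δ) (h : IsBrokenGeodesic p L M c)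
    (hδ0 : 0 ≤ δ) (hL : 2 * c + 4 * δ < L) {i j k : ℤ} (hij : i < j) (hjk : j < k) :
    gromovProduct (p j) (p i) (p k) ≤ c + 2 * δ := by
  have h1 := h.gromovProduct_succ_le hδ hδ0 (by linarith) hij
  have h2 := h.le_gromovProduct_succ hδ hδ0 (by linarith) hjk
  rw [gromovProduct_comm] at h2
  linarith [hδ.gromovProduct_le h1 (by linarith)]

theorem gromovProduct_nearest_le_of_lt (hδ : IsHyperbolic X δ) (h : IsBrokenGeodesic p L M c)
    (hδ0 : 0 ≤ δ) (hL : 2 * c + 2 * δ < L) (hM : M / 2 + c + 2 * δ < L) {y : X} {i j : ℤ}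
    (hy : IsNearest p y i) (hij : i < j) : gromovProduct (p i) y (p j) ≤ M / 2 + δ := by
  -- As `p i` is nearest, the product is at most half of the step.
  have h1 : gromovProduct (p i) y (p (i + 1)) ≤ M / 2 := by
    have := hy (i + 1)
    have := h.step_le i
    unfold gromovProduct
    rw [dist_comm (p (i + 1))]
    linarith
  have h2 := h.le_gromovProduct_succ hδ hδ0 hL hij
  rw [gromovProduct_comm] at h2
  exact hδ.gromovProduct_le h1 (by linarith)

theorem gromovProduct_nearest_le (hδ : IsHyperbolic X δ) (h : IsBrokenGeodesic p L M c)
    (hδ0 : 0 ≤ δ) (hL : 2 * c + 2 * δ < L) (hM : M / 2 + c + 2 * δ < L) {y : X} {i : ℤ}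
    (hy : IsNearest p y i) (j : ℤ) : gromovProduct (p i) y (p j) ≤ M / 2 + δ := by
  rcases lt_trichotomy i j with hij | rfl | hij
  · exact h.gromovProduct_nearest_le_of_lt hδ hδ0 hL hM hy hij
  · have h1 : gromovProduct (p i) y (p i) = 0 := by simp [gromovProduct]
    have h2 := dist_nonneg.trans (h.step_le i)
    linarith
  · have hy' : IsNearest (fun i => p (-i)) y (-i) := fun m => by simpa using hy (-m)
    simpa using h.reverse.gromovProduct_nearest_le_of_lt hδ hδ0 hL hM hy' (neg_lt_neg hij)

/-- The distance to a vertex is almost the length of the path through the nearest vertex. -/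
theorem dist_nearest_add_le (hδ : IsHyperbolic X δ) (h : IsBrokenGeodesic p L M c)
    (hδ0 : 0 ≤ δ) (hL : 2 * c + 2 * δ < L) (hM : M / 2 + c + 2 * δ < L) {y : X} {i : ℤ}
    (hy : IsNearest p y i) (j : ℤ) :
    dist y (p i) + dist (p i) (p j) ≤ dist y (p j) + (M + 2 * δ) := by
  have := h.gromovProduct_nearest_le hδ hδ0 hL hM hy j
  unfold gromovProduct at this
  rw [dist_comm (p j) (p i)] at this
  linarith

theorem le_gromovProduct_nearest (hδ : IsHyperbolic X δ) (h : IsBrokenGeodesic p L M c)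
    (hδ0 : 0 ≤ δ) (hL : 2 * c + 2 * δ < L) (hM : M / 2 + c + 2 * δ < L) {y : X} {i j : ℤ}
    (hy : IsNearest p y i) (hij : L ≤ dist (p i) (p j)) :
    L - (M / 2 + δ) ≤ gromovProduct (p j) y (p i) := by
  have h1 := h.gromovProduct_nearest_le hδ hδ0 hL hM hy j
  have h2 := gromovProduct_add_gromovProduct (p i) (p j) y
  rw [gromovProduct_comm _ _ y, gromovProduct_comm _ _ y] at h2
  linarith

theorem le_dist (hδ : IsHyperbolic X δ) (h : IsBrokenGeodesic p L M c)
    (hδ0 : 0 ≤ δ) (hL : 3 * c + 3 * δ < L) {i j : ℤ} (hij : i < j) :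
    L ≤ dist (p i) (p j) := by
  have hc := h.angle_nonneg
  rcases (show i + 1 ≤ j from hij).eq_or_lt with rfl | hlt
  · exact h.le_step i
  · have h1 := h.gromovProduct_pred_le' hδ hδ0 (by linarith) hlt
    have h2 := h.le_gromovProduct_succ hδ hδ0 (by linarith) hlt
    have h3 := h.le_step i
    have h4 := gromovProduct_add_gromovProduct (p (i + 1)) (p j) (p (i + 1 + 1))
    have h5 := gromovProduct_nonneg (p j) (p (i + 1)) (p (i + 1 + 1))
    rw [gromovProduct_comm (p (i + 1)) (p j)] at h4
    rw [show i + 1 - 1 = i by ring] at h1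
    unfold gromovProduct at h1
    rw [dist_comm (p j) (p (i + 1))] at h1
    linarith

/-- A vertex strictly between the vertices nearest to `y` and `z` is close to the geodesics
from `y` to `z`. -/
theorem gromovProduct_nearest_nearest_le (hδ : IsHyperbolic X δ) (h : IsBrokenGeodesic p L M c)
    (hδ0 : 0 ≤ δ) (hM : M / 2 + 2 * c + 5 * δ < L)
    {y z : X} {i j k : ℤ} (hy : IsNearest p y i) (hz : IsNearest p z k) (hij : i < j)
    (hjk : j < k) : gromovProduct (p j) y z ≤ c + 4 * δ := by
  have hc := h.angle_nonneg
  have hLM := (h.le_step 0).trans (h.step_le 0)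
  have h1 := h.gromovProduct_between_le hδ hδ0 (by linarith) hij hjk
  have h2 := h.le_gromovProduct_nearest hδ hδ0 (by linarith) (by linarith) hy
    (h.le_dist hδ hδ0 (by linarith) hij)
  have h3 := h.le_gromovProduct_nearest hδ hδ0 (by linarith) (by linarith) hz
    ((h.le_dist hδ hδ0 (by linarith) hjk).trans_eq (dist_comm _ _))
  -- Seen from `p j`, `z` and `p k` have a large product, and so do `y` and `p i`. Replacing `p k`
  -- by `z` and `p i` by `y` costs `δ` each.
  have h4 := hδ.gromovProduct_le h1 (y := z) (by linarith)
  rw [gromovProduct_comm] at h4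
  have h5 := hδ.gromovProduct_le h4 (y := y) (by linarith)
  rw [gromovProduct_comm] at h5
  linarith

end IsBrokenGeodesic

end BrokenGeodesic

/-! ### Indices of cells and the symmetric element. -/

section Orbit

variable {G X : Type*} [Group G] [MulAction G X]

/-- The position in `ℤ` of the `i`-th nonzero integer. -/
def position (i : ℤ) : ℤ := if 0 < i then i - 1 else i

theorem orbitPoint_eq (ξ : G) (O : X) (i : ℤ) : orbitPoint ξ O i = ξ ^ position i • O := by
  unfold orbitPoint position
  split_ifs <;> rfl

variable [MetricSpace X]

/-- Zero must be excluded for `i`: both 0 and 1 have position 0. -/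
theorem position_lt_position {i j : ℤ} (hi : i ≠ 0) (hij : i < j) :
    position i < position j := by
  unfold position
  split_ifs <;> omega

theorem exists_position_eq (n : ℤ) : ∃ i : ℤ, i ≠ 0 ∧ position i = n := by
  rcases lt_or_ge n 0 with hn | hn
  · exact ⟨n, by omega, by unfold position; split_ifs <;> omega⟩
  · exact ⟨n + 1, by omega, by unfold position; split_ifs <;> omega⟩

theorem mem_cellIndices_iff (ξ : G) (O x : X) (i : ℤ) :
    i ∈ cellIndices ξ O x ↔ i ≠ 0 ∧ IsNearest (fun n : ℤ => ξ ^ n • O) x (position i) := by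
  unfold cellIndices cell IsNearest
  simp only [Set.mem_ofPred_eq, orbitPoint_eq]
  refine and_congr_right fun _ => ⟨fun h n => ?_, fun h j _ => h _⟩
  obtain ⟨j, hj, rfl⟩ := exists_position_eq n
  exact h j hj

theorem symm_of_pos {ξ : G} {O : X} {β : G} (h : 0 < index ξ O β) :
    symm ξ O β = ξ ^ (-2 * index ξ O β - 1) * β := if_pos h

theorem symm_of_neg {ξ : G} {O : X} {β : G} (h : index ξ O β < 0) :
    symm ξ O β = ξ ^ (-2 * index ξ O β + 1) * β := if_neg h.not_gt

theorem signed_one (ξ : G) (O : X) (β : G) : signed ξ O β 1 = β := if_pos rfl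

theorem signed_neg_one (ξ : G) (O : X) (β : G) : signed ξ O β (-1) = symm ξ O β :=
  if_neg (by decide)

theorem star_eq_or (ξ : G) (O : X) (α β : G) :
    star ξ O α β = α * β ∨ star ξ O α β = α * symm ξ O β := by
  rw [← signed_neg_one ξ O β]
  nth_rewrite 2 [← signed_one ξ O β]
  unfold star
  split_ifs <;> simp

theorem SameSign.swap {ξ : G} {O : X} {β β' : G} (h : SameSign ξ O β β') : SameSign ξ O β' β :=
  Or.imp And.symm And.symm h

variable [IsIsometricSMul G X] {ξ : G}

theorem cellIndex_ne_zero (hξ : IsHyperbolicElement X ξ) (O x : X) : cellIndex ξ O x ≠ 0 :=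
  (isLeast_cellIndex ξ hξ O x).1.1

/-- Powers of `ξ` translate exponents but not indices, which skip 0; hence the passage to positions.
-/
theorem isLeast_position (hξ : IsHyperbolicElement X ξ) (O x : X) :
    IsLeast {n | IsNearest (fun n : ℤ => ξ ^ n • O) x n} (position (cellIndex ξ O x)) := by
  obtain ⟨h1, h2⟩ := isLeast_cellIndex ξ hξ O x
  refine ⟨((mem_cellIndices_iff ξ O x _).1 h1).2, fun n hn => ?_⟩
  obtain ⟨i, hi, rfl⟩ := exists_position_eq n
  have h3 := h2 ((mem_cellIndices_iff ξ O x i).2 ⟨hi, hn⟩)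
  rcases h3.eq_or_lt with h | h
  · rw [h]
  · exact (position_lt_position h1.1 h).le

theorem dist_zpow_smul_zpow_smul (ξ : G) (x y : X) (k n : ℤ) :
    dist (ξ ^ k • x) (ξ ^ n • y) = dist x (ξ ^ (n - k) • y) := by
  rw [← dist_smul (ξ ^ k) x, smul_smul, ← zpow_add, add_sub_cancel]

theorem isNearest_zpow_smul_iff (ξ : G) (O x : X) (k n : ℤ) :
    IsNearest (fun n : ℤ => ξ ^ n • O) (ξ ^ k • x) n ↔
      IsNearest (fun n : ℤ => ξ ^ n • O) x (n - k) := by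
  unfold IsNearest
  simp only [dist_zpow_smul_zpow_smul]
  refine ⟨fun h m => ?_, fun h m => h _⟩
  simpa using h (m + k)

theorem position_cellIndex_zpow_smul (hξ : IsHyperbolicElement X ξ) (O x : X) (k : ℤ) :
    position (cellIndex ξ O (ξ ^ k • x)) = position (cellIndex ξ O x) + k := by
  have h1 := isLeast_position hξ O (ξ ^ k • x)
  have h2 := isLeast_position hξ O x
  refine h1.unique ⟨(isNearest_zpow_smul_iff ξ O x k _).2 (by simpa using h2.1), fun n hn => ?_⟩
  have := h2.2 ((isNearest_zpow_smul_iff ξ O x k n).1 hn)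
  linarith

theorem index_ne_zero (hξ : IsHyperbolicElement X ξ) (O : X) (β : G) : index ξ O β ≠ 0 :=
  cellIndex_ne_zero hξ O _

theorem index_symm_of_pos (hξ : IsHyperbolicElement X ξ) {O : X} {β : G}
    (h : 0 < index ξ O β) : index ξ O (symm ξ O β) = -index ξ O β - 2 := by
  have h1 := position_cellIndex_zpow_smul hξ O (β • O) (-2 * index ξ O β - 1)
  have h0 := index_ne_zero hξ O (symm ξ O β)
  rw [← mul_smul, ← symm_of_pos h] at h1
  change position (index ξ O (symm ξ O β)) = position (index ξ O β) + _ at h1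
  unfold position at h1
  split_ifs at h1 <;> omega

theorem index_symm_of_neg (hξ : IsHyperbolicElement X ξ) {O : X} {β : G}
    (h : index ξ O β < 0) : index ξ O (symm ξ O β) = -index ξ O β + 2 := by
  have h1 := position_cellIndex_zpow_smul hξ O (β • O) (-2 * index ξ O β + 1)
  have h0 := index_ne_zero hξ O (symm ξ O β)
  rw [← mul_smul, ← symm_of_neg h] at h1
  change position (index ξ O (symm ξ O β)) = position (index ξ O β) + _ at h1
  unfold position at h1
  split_ifs at h1 <;> omega

theorem exists_star_eq_separates (hξ : IsHyperbolicElement X ξ) (O : X) (α β : G) :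
    ∃ s : ℤˣ, star ξ O α β = α * signed ξ O β s ∧
      ∃ k : ℤ, (k = 1 ∨ k = -1 ∨ k = 2 ∨ k = -2) ∧
        Separates ξ O k (α⁻¹ • O) (signed ξ O β s • O) := by
  by_cases h : Separates ξ O 1 (α⁻¹ • O) (β • O) ∨ Separates ξ O (-1) (α⁻¹ • O) (β • O)
  · refine ⟨1, if_pos h, ?_⟩
    rw [signed_one]
    rcases h with h | h
    · exact ⟨1, by simp, h⟩
    · exact ⟨-1, by simp, h⟩
  · refine ⟨-1, if_neg h, ?_⟩
    rw [signed_neg_one]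
    have ha := cellIndex_ne_zero hξ O (α⁻¹ • O)
    -- If `β` is positive, non-separation puts the index of `α⁻¹ • O` at `-1` or above, while that
    -- of `β_-` is at most `-3`; so `D_{-2}` separates. The negative case is symmetric, with `D_2`.
    have hs : Separates ξ O 2 (α⁻¹ • O) (symm ξ O β • O) ∨
        Separates ξ O (-2) (α⁻¹ • O) (symm ξ O β • O) := by
      unfold Separates at h ⊢
      rcases (index_ne_zero hξ O β).lt_or_gt with hb | hb
      · have h1 := index_symm_of_neg hξ hb
        unfold index at h1 hb
        omega
      · have h1 := index_symm_of_pos hξ hb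
        unfold index at h1 hb
        omega
    rcases hs with h | h
    · exact ⟨2, by simp, h⟩
    · exact ⟨-2, by simp, h⟩

theorem symm_injective_of_sameSign (hξ : IsHyperbolicElement X ξ) {O : X} {β β' : G}
    (hs : SameSign ξ O β β') (h : symm ξ O β = symm ξ O β') : β = β' := by
  rcases hs with ⟨h1, h2⟩ | ⟨h1, h2⟩
  · have e := index_symm_of_pos hξ h1
    rw [h, index_symm_of_pos hξ h2] at e
    rw [symm_of_pos h1, symm_of_pos h2, show index ξ O β = index ξ O β' by omega] at h
    exact mul_left_cancel h
  · have e := index_symm_of_neg hξ h1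
    rw [h, index_symm_of_neg hξ h2] at e
    rw [symm_of_neg h1, symm_of_neg h2, show index ξ O β = index ξ O β' by omega] at h
    exact mul_left_cancel h

theorem ne_symm_of_sameSign (hξ : IsHyperbolicElement X ξ) {O : X} {β β' : G}
    (hs : SameSign ξ O β β') : β ≠ symm ξ O β' := by
  intro h
  rcases hs with ⟨h1, h2⟩ | ⟨h1, h2⟩
  · have e := index_symm_of_pos hξ h2
    unfold IsPositive at h1 h2
    rw [← h] at e
    omega
  · have e := index_symm_of_neg hξ h2
    unfold IsNegative at h1 h2
    rw [← h] at e
    omega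

theorem star_injective_of_sameSign (hξ : IsHyperbolicElement X ξ) {O : X} {α β β' : G}
    (h : star ξ O α β = star ξ O α β') (hs : SameSign ξ O β β') : β = β' := by
  rcases star_eq_or ξ O α β with h1 | h1 <;> rcases star_eq_or ξ O α β' with h2 | h2 <;>
    rw [h1, h2] at h <;> replace h := mul_left_cancel h
  · exact h
  · exact absurd h (ne_symm_of_sameSign hξ hs)
  · exact absurd h.symm (ne_symm_of_sameSign hξ hs.swap)
  · exact symm_injective_of_sameSign hξ hs h

/-! ### Metric estimates along the orbit of `O`. -/

/-- The orbit of a point that `ξ` displaces almost minimally is a broken geodesic. -/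
theorem isBrokenGeodesic_orbit (hgeod : IsGeodesic X) {δ : ℝ} (hδ : IsHyperbolic X δ)
    {L ε : ℝ} (hL : ∀ x : X, L ≤ dist x (ξ • x)) (hLδ : 4 * δ + ε < L) {O : X}
    (hO : dist O (ξ • O) ≤ L + ε) (hδ0 : 0 ≤ δ) :
    IsBrokenGeodesic (fun n : ℤ => ξ ^ n • O) L (L + ε) (ε / 2 + 2 * δ) := by
  have step : ∀ i : ℤ, dist (ξ ^ i • O) (ξ ^ (i + 1) • O) = dist O (ξ • O) := fun i => by
    rw [dist_zpow_smul_zpow_smul, add_sub_cancel_left, zpow_one]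
  have angle : gromovProduct (ξ • O) O (ξ • ξ • O) ≤ ε / 2 + 2 * δ := by
    obtain ⟨γ, h0, h1, hγ⟩ := hgeod O (ξ • O)
    set d := dist O (ξ • O)
    have hd : 0 ≤ d := dist_nonneg
    have hdL : L ≤ d := hL O
    set m := γ (d / 2)
    have hm0 : dist O m = d / 2 := by
      have := hγ 0 ⟨le_rfl, hd⟩ (d / 2) ⟨by linarith, by linarith⟩
      rwa [h0, zero_sub, abs_neg, abs_of_nonneg (by linarith)] at this
    have hm1 : dist m (ξ • O) = d / 2 := by
      have := hγ (d / 2) ⟨by linarith, by linarith⟩ d ⟨hd, le_rfl⟩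
      rwa [h1, abs_of_nonpos (by linarith), show -(d / 2 - d) = d / 2 by ring] at this
    have e1 : dist (ξ • m) (ξ • O) = d / 2 := by rw [dist_smul, dist_comm, hm0]
    have e2 : dist (ξ • m) (ξ • ξ • O) = d / 2 := by rw [dist_smul, hm1]
    have e3 : dist (ξ • O) (ξ • ξ • O) = d := dist_smul _ _ _
    -- The midpoint `m` is also displaced by at least `L`, so the path through `ξ • O` from `m` to
    -- `ξ • m` cannot backtrack much. Moving out to the endpoints `O` and `ξ • ξ • O` costs `δ`
    -- each.
    have a1 : gromovProduct (ξ • O) m (ξ • m) ≤ ε / 2 := by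
      have := hL m
      unfold gromovProduct
      linarith
    have a2 : gromovProduct (ξ • O) O m = d / 2 := by
      unfold gromovProduct
      rw [hm0, hm1]
      change (d + d / 2 - d / 2) / 2 = _
      ring
    have a3 : gromovProduct (ξ • O) (ξ • ξ • O) (ξ • m) = d / 2 := by
      unfold gromovProduct
      rw [dist_comm _ (ξ • m), e1, e2, dist_comm _ (ξ • O), e3]
      ring
    have b1 := hδ.gromovProduct_le a1 (y := ξ • ξ • O) (by linarith)
    rw [gromovProduct_comm] at b1
    have b2 := hδ.gromovProduct_le b1 (y := O) (by linarith)
    rw [gromovProduct_comm] at b2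
    linarith
  refine ⟨fun i => (hL O).trans_eq (step i).symm, fun i => (step i).trans_le hO, fun i => ?_⟩
  have e : gromovProduct (ξ ^ i • O) (ξ ^ (i - 1) • O) (ξ ^ (i + 1) • O) =
      gromovProduct (ξ • O) O (ξ • ξ • O) := by
    have e1 : ξ ^ i • O = ξ ^ (i - 1) • ξ • O := by
      rw [smul_smul, ← zpow_add_one, sub_add_cancel]
    have e2 : ξ ^ (i + 1) • O = ξ ^ (i - 1) • ξ • ξ • O := by
      rw [smul_smul, smul_smul, ← zpow_add_one, ← zpow_add_one]
      congr 2
      ring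
    unfold gromovProduct
    rw [e1, e2]
    simp only [dist_smul]
  exact e.trans_le angle

/-- Translating along the axis to a position almost opposite changes the distance to the base
point by a bounded amount. -/
theorem abs_dist_zpow_smul_sub_le {δ : ℝ} (hδ : IsHyperbolic X δ) {L M c : ℝ} {O : X}
    (h : IsBrokenGeodesic (fun n : ℤ => ξ ^ n • O) L M c) (hδ0 : 0 ≤ δ)
    (hL : 2 * c + 2 * δ < L) (hM : M / 2 + c + 2 * δ < L) {x : X} {n : ℤ}
    (hx : IsNearest (fun n : ℤ => ξ ^ n • O) x n) (k : ℤ) :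
    |dist O (ξ ^ k • x) - dist O x| ≤ |((2 * n + k : ℤ) : ℝ)| * M + (M + 2 * δ) := by
  have hx' : IsNearest (fun n : ℤ => ξ ^ n • O) (ξ ^ k • x) (n + k) :=
    (isNearest_zpow_smul_iff ξ O x k _).2 (by simpa using hx)
  have h1 := h.dist_nearest_add_le hδ hδ0 hL hM hx 0
  have h2 := h.dist_nearest_add_le hδ hδ0 hL hM hx' 0
  -- The vertices `n + k` and `-(n + k)` are equidistant from `O`, and the latter is `|2 * n + k|`
  -- steps from `n`.
  have h3 := h.dist_le (-(n + k)) n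
  have e1 : dist (ξ ^ k • x) (ξ ^ (n + k) • O) = dist x (ξ ^ n • O) := by
    rw [dist_zpow_smul_zpow_smul, add_sub_cancel_right]
  have e2 : dist (ξ ^ (n + k) • O) O = dist (ξ ^ (-(n + k)) • O) O := by
    have := dist_zpow_smul_zpow_smul ξ O O (n + k) 0
    rw [zero_sub, zpow_zero, one_smul] at this
    rw [this, dist_comm]
  have t1 := dist_triangle x (ξ ^ n • O) O
  have t2 := dist_triangle (ξ ^ k • x) (ξ ^ (n + k) • O) O
  have t3 := dist_triangle (ξ ^ (-(n + k)) • O) (ξ ^ n • O) O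
  have t4 := dist_triangle_left (ξ ^ n • O) O (ξ ^ (-(n + k)) • O)
  simp only [zpow_zero, one_smul] at h1 h2
  rw [show n - -(n + k) = 2 * n + k by ring] at h3
  rw [dist_comm O, dist_comm O]
  rw [e1, e2] at h2 t2
  rw [abs_sub_le_iff]
  constructor <;> linarith

theorem abs_orbitNorm_symm_sub_le {δ : ℝ} (hδ : IsHyperbolic X δ)
    (hξ : IsHyperbolicElement X ξ) {L M c : ℝ} {O : X}
    (h : IsBrokenGeodesic (fun n : ℤ => ξ ^ n • O) L M c) (hδ0 : 0 ≤ δ)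
    (hL : 2 * c + 2 * δ < L) (hM : M / 2 + c + 2 * δ < L) (β : G) :
    |orbitNorm O (symm ξ O β) - orbitNorm O β| ≤ 4 * M + 2 * δ := by
  have hM0 : 0 ≤ M := dist_nonneg.trans (h.step_le 0)
  have hn : IsNearest (fun n : ℤ => ξ ^ n • O) (β • O) (position (index ξ O β)) :=
    (isLeast_position hξ O (β • O)).1
  rcases (index_ne_zero hξ O β).lt_or_gt with hb | hb
  · have := abs_dist_zpow_smul_sub_le hδ h hδ0 hL hM hn (-2 * index ξ O β + 1)
    rw [← mul_smul, ← symm_of_neg hb, position, if_neg hb.not_gt,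
      show 2 * index ξ O β + (-2 * index ξ O β + 1) = 1 by ring, Int.cast_one, abs_one] at this
    exact this.trans (by linarith)
  · have := abs_dist_zpow_smul_sub_le hδ h hδ0 hL hM hn (-2 * index ξ O β - 1)
    rw [← mul_smul, ← symm_of_pos hb, position, if_pos hb,
      show 2 * (index ξ O β - 1) + (-2 * index ξ O β - 1) = -3 by ring] at this
    norm_num at this
    exact this.trans (by linarith)

theorem gromovProduct_le_of_separates {δ : ℝ} (hδ : IsHyperbolic X δ)
    (hξ : IsHyperbolicElement X ξ) {L M c : ℝ} {O : X}
    (h : IsBrokenGeodesic (fun n : ℤ => ξ ^ n • O) L M c) (hδ0 : 0 ≤ δ)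
    (hM : M / 2 + 2 * c + 5 * δ < L) {k : ℤ} (hk : k ≠ 0) {y z : X}
    (hs : Separates ξ O k y z) : gromovProduct (orbitPoint ξ O k) y z ≤ c + 4 * δ := by
  rw [orbitPoint_eq]
  have hy := (isLeast_position hξ O y).1
  have hz := (isLeast_position hξ O z).1
  rcases hs with ⟨h1, h2⟩ | ⟨h1, h2⟩
  · exact h.gromovProduct_nearest_nearest_le hδ hδ0 hM hy hz
      (position_lt_position (cellIndex_ne_zero hξ O y) h1) (position_lt_position hk h2)
  · rw [gromovProduct_comm]
    exact h.gromovProduct_nearest_nearest_le hδ hδ0 hM hz hy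
      (position_lt_position (cellIndex_ne_zero hξ O z) h1) (position_lt_position hk h2)

theorem orbitNorm_mul (O : X) (α β : G) : orbitNorm O (α * β) = dist (α⁻¹ • O) (β • O) := by
  rw [orbitNorm, ← dist_smul α (α⁻¹ • O), smul_inv_smul, mul_smul]

theorem orbitNorm_inv (O : X) (α : G) : orbitNorm O α⁻¹ = orbitNorm O α := by
  rw [orbitNorm, orbitNorm, ← dist_smul α O (α⁻¹ • O), smul_inv_smul, dist_comm]

end Orbit

end TwistedProduct

theorem proposition7p2 {G X : Type*} [Group G] [Group.FG G] [MetricSpace X] [ProperSpace X]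
    [MulAction G X] [IsIsometricSMul G X] (hgeod : TwistedProduct.IsGeodesic X)
    (δ : ℝ) (hδ : TwistedProduct.IsHyperbolic X δ)
    (ξ : G) (hξ : TwistedProduct.IsHyperbolicElement X ξ)
    (L : ℝ) (hL : L = TwistedProduct.minDisplacement X ξ) (hLδ : 300 * δ ≤ L)
    (ε : ℝ) (hε : 0 < ε) (hεδ : ε < δ)
    (O : X) (hO : dist O (ξ • O) ≤ L + ε) (α β β' : G) :
    (∃ s : ℤˣ, TwistedProduct.star ξ O α β = α * TwistedProduct.signed ξ O β s ∧
      ∃ k : ℤ, (k = 1 ∨ k = -1 ∨ k = 2 ∨ k = -2) ∧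
        TwistedProduct.Separates ξ O k (α⁻¹ • O) (TwistedProduct.signed ξ O β s • O)) ∧
    (TwistedProduct.star ξ O α β = TwistedProduct.star ξ O α β' →
      TwistedProduct.SameSign ξ O β β' → β = β') ∧
    (TwistedProduct.orbitNorm O α + TwistedProduct.orbitNorm O β
        - (12 * L + 758 * δ + 12 * ε) ≤
        TwistedProduct.orbitNorm O (TwistedProduct.star ξ O α β) ∧
      TwistedProduct.orbitNorm O (TwistedProduct.star ξ O α β) ≤
        TwistedProduct.orbitNorm O α + TwistedProduct.orbitNorm O β
        + (12 * L + 758 * δ + 12 * ε)) ∧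
    12 * L + 758 * δ + 12 * ε ≤ 20 * L := by

  have hδ0 : 0 < δ := hε.trans hεδ
  have hmin : ∀ x : X, L ≤ dist x (ξ • x) := fun x =>
    hL.trans_le (ciInf_le ⟨0, by rintro _ ⟨y, rfl⟩; exact dist_nonneg⟩ x)
  have hp := TwistedProduct.isBrokenGeodesic_orbit hgeod hδ hmin (by linarith) hO hδ0.le
  have hpart := TwistedProduct.exists_star_eq_separates hξ O α β
  refine ⟨hpart, TwistedProduct.star_injective_of_sameSign hξ, ?_, by linarith⟩
  obtain ⟨s, hs, k, hk, hsep⟩ := hpart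
  have hnorm : |TwistedProduct.orbitNorm O (TwistedProduct.signed ξ O β s)
      - TwistedProduct.orbitNorm O β| ≤ 4 * (L + ε) + 2 * δ := by
    rcases Int.units_eq_one_or s with rfl | rfl
    · rw [TwistedProduct.signed_one, sub_self, abs_zero]
      linarith
    · rw [TwistedProduct.signed_neg_one]
      exact TwistedProduct.abs_orbitNorm_symm_sub_le hδ hξ hp hδ0.le (by linarith)
        (by linarith) β
  have hprod := TwistedProduct.gromovProduct_le_of_separates hδ hξ hp hδ0.le (by linarith)
    (by omega) hsep
  -- The positions of 1, -1, 2, -2 are 0, -1, 1, -2.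
  have hbase : dist O (TwistedProduct.orbitPoint ξ O k) ≤ 2 * (L + ε) := by
    have h := hp.dist_le 0 (TwistedProduct.position k)
    simp only [zpow_zero, one_smul, sub_zero] at h
    rw [TwistedProduct.orbitPoint_eq]
    refine h.trans (mul_le_mul_of_nonneg_right ?_ (by linarith))
    rcases hk with rfl | rfl | rfl | rfl <;> norm_num [TwistedProduct.position]
  rw [abs_sub_le_iff] at hnorm
  have hα := TwistedProduct.orbitNorm_inv O α
  rw [hs, TwistedProduct.orbitNorm_mul, ← hα]
  unfold TwistedProduct.orbitNorm at hnorm ⊢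
  unfold TwistedProduct.gromovProduct at hprod
  set y := α⁻¹ • O
  set z := TwistedProduct.signed ξ O β s • O
  have t1 := dist_triangle_right O y (TwistedProduct.orbitPoint ξ O k)
  have t2 := dist_triangle_right O z (TwistedProduct.orbitPoint ξ O k)
  have t3 := dist_triangle_left y z O
  -- The lower bound loses at most `4 * (L + ε)` for the detour to the vertex, `ε + 12 * δ` for the
  -- Gromov product and `4 * (L + ε) + 2 * δ` for the change of sign, less than the stated constant.
  -- The upper bound needs only the triangle inequality and the last term.
  constructor <;> linarith
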